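/- Let $R$ be the $4\times 4$ rook's graph (vertices $\{1,\dots,4\}^2$, two vertices adjacent iff they differ in exactly one coordinate) and let $S$ be the Shrikhande graph (the Cayley graph of $(\mathbb Z/4)^2$ with connection set $\{\pm(1,0),\pm(0,1),\pm(1,1)\}$). Both are strongly regular with parameters $(16,6,2,2)$, and they are not isomorphic. *Simplicial transformers.* For a finite graph $G$ let $\mathcal K$ be its clique complex, whose simplices are the nonempty cliques. Fix an orientation of its simplices (vertices being positively oriented), let $\mathbf B_k$ be the resulting boundary matrix (rows: $(k-1)$-simplices, columns: $k$-simplices), and let $\mathbf L_k=\mathbf B_k^{\top}\mathbf B_k+\mathbf B_{k+1}\mathbf B_{k+1}^{\top}$ (with $\mathbf B_0=0$) be the Hodge Laplacians. The inter-order Hodge Laplacian $\mathcal L_{0:K}$ is the block matrix indexed by the simplices of dimension at most $K$ with diagonal blocks $\mathbf L_k$, with $\mathbf B_{k+1}$ directly above and $\mathbf B_{k+1}^{\top}$ directly below the diagonal, and with zero blocks elsewhere. A simplicial transformer $\mathcal{AS}_{0:K}$ with $\mathcal L_{0:K}$ as attention bias acts on row feature vectors of the simplices of dimension at most $K$. It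 consists of an input ReLU MLP applied to each simplex, one or more layers, a pooling of the simplex features, and a final ReLU MLP with real output. In each layer every attention head computes $$\mathrm{softmax}\big(\mathbf X Q(\mathbf X K)^{\top}+\phi(\mathcal L_{0:K})\big)\begin{bmatrix}\mathbf X_0V^0\\ \vdots\\ \mathbf X_KV^K\end{bmatrix}$$ (row-wise softmax; $\mathbf X_k$ is the block of rows of the $k$-simplices; bias terms are allowed after $Q$, $K$ and each $V^k$; $\phi:\mathbb R\to\mathbb R$ is applied entrywise). The outputs of the heads are linearly projected and summed, a residual connection is optionally added, and a ReLU MLP is applied to each simplex. The initial feature of a simplex depends only on its dimension. The pooling is the sum, the mean or the entrywise maximum over all simplices of dimension at most $K$, or over the $0$-simplices only. Such a transformer distinguishes two graphs if its outputs on them differ for all choices of orientations of their simplices. *$k$-WL.* This is the oblivious (non-folklore) $k$-dimensional Weisfeiler–Leman test. The initial colour of a $k$-tuple of vertices is its isomorphism type (equality pattern and adjacency pattern), and in each round $$c^{t}(\mathbf v)=\mathrm{Hash}\Big(c^{t-1}(\mathbf v),\big(\{\!\{c^{t-1}(\mathbf v[i\leftarrow u])\mid u\in V(G)\}\!\}\big)_{i=1}^{k}\Big)$$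 with an injective hash function, where $\mathbf v[i\leftarrow u]$ is $\mathbf v$ with its $i$-th entry replaced by $u$. It distinguishes two graphs if for some $t$ the multisets of the colours of all $k$-tuples differ. **Theorem.** For every entrywise function $\phi:\mathbb R\to\mathbb R$ (for example the identity), every $d_0\ge 0$, every choice of initial features in $\mathbb R^{d_0}$ that depend only on the dimension of the simplex, and each of the poolings above, there is a simplicial transformer $\mathcal{AS}_{0:3}$ with attention bias $\phi(\mathcal L_{0:3})$ that distinguishes $R$ from $S$. In contrast, $3$-WL does not distinguish $R$ from $S$. -/

import Mathlib

noncomputable section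

/-! ### The two graphs -/

/-- The `n × n` rook's graph: squares of a board, adjacent when they differ in exactly one
coordinate, that is, the Cartesian product of two complete graphs. -/
def rookGraph (n : ℕ) : SimpleGraph (Fin n × Fin n) :=
  SimpleGraph.boxProd (⊤ : SimpleGraph (Fin n)) (⊤ : SimpleGraph (Fin n))

/-- The Shrikhande graph: the Cayley graph of `ℤ/4 × ℤ/4` with connection set
`{±(1,0), ±(0,1), ±(1,1)}`. -/
def shrikhandeGraph : SimpleGraph (ZMod 4 × ZMod 4) where
  Adj u v := v - u ∈ ({(1, 0), (-1, 0), (0, 1), (0, -1), (1, 1), (-1, -1)} :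
    Finset (ZMod 4 × ZMod 4))
  symm := ⟨by decide⟩
  loopless := ⟨by decide⟩

instance (n : ℕ) : DecidableRel (rookGraph n).Adj := fun x y =>
  decidable_of_iff _ (SimpleGraph.boxProd_adj (x := x) (y := y)).symm

instance : DecidableRel shrikhandeGraph.Adj := fun u v =>
  inferInstanceAs (Decidable (v - u ∈ ({(1, 0), (-1, 0), (0, 1), (0, -1), (1, 1), (-1, -1)} :
    Finset (ZMod 4 × ZMod 4))))

/-! ### The `k`-dimensional Weisfeiler-Leman test (the oblivious, non-folklore version) -/

/-- The colours used after `t` rounds of `k`-WL. Initially a colour is the isomorphism type of an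
ordered `k`-tuple: its equality pattern and its adjacency pattern. The hash function is the
identity, so it is injective by construction. -/
def WLColor (k : ℕ) : ℕ → Type
  | 0 => (Fin k → Fin k → Prop) × (Fin k → Fin k → Prop)
  | t + 1 => WLColor k t × (Fin k → Multiset (WLColor k t))

/-- The colour of the tuple `v` after `t` rounds: in each round the old colour is combined, for
each position `i`, with the multiset of the colours of all tuples obtained from `v` by replacing
its `i`-th entry. -/
def wlColor {V : Type*} [Fintype V] [DecidableEq V] (G : SimpleGraph V) (k : ℕ) :
    (t : ℕ) → (Fin k → V) → WLColor k t
  | 0, v => (fun i j => v i = v j, fun i j => G.Adj (v i) (v j))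
  | t + 1, v => (wlColor G k t v,
      fun i => Finset.univ.val.map fun u : V => wlColor G k t (Function.update v i u))

/-- The colour of the whole graph: the multiset of the colours of all `k`-tuples. -/
def wlGraphColor {V : Type*} [Fintype V] [DecidableEq V] (G : SimpleGraph V) (k t : ℕ) :
    Multiset (WLColor k t) :=
  Finset.univ.val.map (wlColor G k t)

/-- `k`-WL distinguishes two graphs if their colours differ after some number of rounds. -/
def WLDistinguishes (k : ℕ) {V W : Type*} [Fintype V] [DecidableEq V] [Fintype W] [DecidableEq W]
    (G : SimpleGraph V) (H : SimpleGraph W) : Prop :=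
  ∃ t : ℕ, wlGraphColor G k t ≠ wlGraphColor H k t

/-! ### Simplicial complexes and Hodge Laplacians -/

/-- The clique (flag) complex of a graph: its simplices are the nonempty cliques. -/
def cliqueComplex {V : Type*} (G : SimpleGraph V) : AbstractSimplicialComplex V where
  faces := {s | s.Nonempty ∧ G.IsClique (s : Set V)}
  isRelLowerSet_faces := fun _ hs =>
    ⟨hs.1, fun _ hts ht => ⟨ht, hs.2.subset (Finset.coe_subset.mpr hts)⟩⟩
  singleton_mem := fun v => ⟨Finset.singleton_nonempty v, by simp⟩

/-- An orientation of the simplices on a vertex set: each simplex is oriented by listing its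
vertices in increasing order of their labels, and this orientation is reversed if the sign of the
simplex is `-1`. All orientations of the simplices of positive dimension arise in this way;
vertices are always positively oriented. -/
structure SimplexOrientation (V : Type*) where
  label : V → ℕ
  label_injective : Function.Injective label
  sign : Finset V → ℤˣ
  sign_singleton : ∀ v, sign {v} = 1

section Hodge

variable {V : Type*} [Fintype V] [DecidableEq V]

/-- All simplices of a complex. -/
abbrev Face (C : AbstractSimplicialComplex V) : Type _ := {s : Finset V // s ∈ C.faces}

/-- The simplices of dimension at most `K`. -/
abbrev FaceUpTo (C : AbstractSimplicialComplex V) (K : ℕ) : Type _ :=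
  {s : Finset V // s ∈ C.faces ∧ s.card ≤ K + 1}

instance (C : AbstractSimplicialComplex V) : Fintype (Face C) := Fintype.ofFinite _

instance (C : AbstractSimplicialComplex V) (K : ℕ) : Fintype (FaceUpTo C K) := Fintype.ofFinite _

/-- The dimension of a simplex, one less than its number of vertices. -/
def FaceUpTo.dim {C : AbstractSimplicialComplex V} {K : ℕ} (s : FaceUpTo C K) : Fin (K + 1) :=
  ⟨s.1.card - 1, by have := s.2.2; omega⟩

/-- The incidence number of `s` in `t`: zero unless `s` arises from `t` by deleting one vertex
`v`, and `(-1) ^ j` for the induced orientations if `v` is the `j`-th vertex of `t`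
(`j = 0, 1, …`). -/
def incidence (o : SimplexOrientation V) (s t : Finset V) : ℝ :=
  if s ⊆ t ∧ t.card = s.card + 1 then
    ((o.sign s : ℤ) : ℝ) * ((o.sign t : ℤ) : ℝ) *
      (-1) ^ (s.filter fun w => ∃ v ∈ t \ s, o.label w < o.label v).card
  else 0

/-- The boundary matrices `B₁, B₂, …` of the complex, assembled into one matrix: its block with
rows the `k`-simplices and columns the `(k+1)`-simplices is `B_{k+1}`, and the rest vanishes. -/
def boundaryMatrix (C : AbstractSimplicialComplex V) (o : SimplexOrientation V) :
    Matrix (Face C) (Face C) ℝ :=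
  Matrix.of fun s t => incidence o s.1 t.1

/-- The Hodge Laplacian of the complex. As the boundary matrix changes the dimension by one, this
is block diagonal, with diagonal blocks `L_k = B_kᵀ B_k + B_{k+1} B_{k+1}ᵀ` (where `B₀ = 0`). -/
def hodgeLaplacian (C : AbstractSimplicialComplex V) (o : SimplexOrientation V) :
    Matrix (Face C) (Face C) ℝ :=
  (boundaryMatrix C o).transpose * boundaryMatrix C o +
    boundaryMatrix C o * (boundaryMatrix C o).transpose

/-- The inter-order Hodge Laplacian `ℒ_{0:K}`: the block matrix on the simplices of dimension at
most `K` with diagonal blocks `L_k`, blocks `B_{k+1}` right above and `B_{k+1}ᵀ` right below the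
diagonal, and zero blocks elsewhere. -/
def interOrderHodgeLaplacian (C : AbstractSimplicialComplex V) (o : SimplexOrientation V) (K : ℕ) :
    Matrix (FaceUpTo C K) (FaceUpTo C K) ℝ :=
  (hodgeLaplacian C o + boundaryMatrix C o + (boundaryMatrix C o).transpose).submatrix
    (fun s => ⟨s.1, s.2.1⟩) (fun s => ⟨s.1, s.2.1⟩)

end Hodge

/-! ### Simplicial transformers with attention bias -/

/-- The parameters of a multilayer perceptron with ReLU activation, from `ℝ^a` to `ℝ^b`. -/
inductive MLP : ℕ → ℕ → Type
  | affine {a b : ℕ} (W : Matrix (Fin a) (Fin b) ℝ) (c : Fin b → ℝ) : MLP a b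
  | hidden {a b m : ℕ} (W : Matrix (Fin a) (Fin m) ℝ) (c : Fin m → ℝ) (rest : MLP m b) : MLP a b

/-- The function computed by a multilayer perceptron (features are row vectors). -/
def MLP.eval : {a b : ℕ} → MLP a b → (Fin a → ℝ) → (Fin b → ℝ)
  | _, _, .affine W c, x => Matrix.vecMul x W + c
  | _, _, .hidden W c rest, x => rest.eval fun i => max ((Matrix.vecMul x W + c) i) 0

/-- The parameters of one attention head on simplices of dimension at most `K`: query and key
matrices shared by all dimensions, one value matrix `V^k` for each dimension `k`, bias terms, and
the output projection of the head. -/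
structure AttentionHead (K d : ℕ) where
  (dk dv : ℕ)
  WQ : Matrix (Fin d) (Fin dk) ℝ
  bQ : Fin dk → ℝ
  WK : Matrix (Fin d) (Fin dk) ℝ
  bK : Fin dk → ℝ
  WV : Fin (K + 1) → Matrix (Fin d) (Fin dv) ℝ
  bV : Fin (K + 1) → Fin dv → ℝ
  WO : Matrix (Fin dv) (Fin d) ℝ

/-- A transformer layer: multi-head attention, an optional residual connection, and a tokenwise
multilayer perceptron. -/
structure TransformerLayer (K d d' : ℕ) where
  heads : List (AttentionHead K d)
  residual : Bool
  mlp : MLP d d'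

/-- A composition of one or more transformer layers. -/
inductive TransformerLayers (K : ℕ) : ℕ → ℕ → Type
  | single {d d' : ℕ} (l : TransformerLayer K d d') : TransformerLayers K d d'
  | cons {d m d' : ℕ} (l : TransformerLayer K d m) (rest : TransformerLayers K m d') :
      TransformerLayers K d d'

/-- A simplicial transformer `AS_{0:K}` with input features in `ℝ^{d₀}` and a real graph-level
output: an input multilayer perceptron, one or more transformer layers, and a multilayer
perceptron applied after the pooling. -/
structure SimplicialTransformer (K d₀ : ℕ) where
  (d d' : ℕ)
  input : MLP d₀ d
  layers : TransformerLayers K d d'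
  output : MLP d' 1

/-- The aggregation used by the graph-level pooling. -/
inductive Aggregation
  | sum
  | mean
  | max

/-- The simplices over which the graph-level pooling runs. -/
inductive PoolingScope
  | allSimplices
  | vertices

def Aggregation.apply {ι : Type*} [Fintype ι] {d : ℕ} :
    Aggregation → (ι → Fin d → ℝ) → (Fin d → ℝ)
  | .sum, X => fun c => ∑ i, X i c
  | .mean, X => fun c => (∑ i, X i c) / Fintype.card ι
  | .max, X => fun c => ⨆ i, X i c

/-- Row-wise softmax. -/
def softmaxRows {ι κ : Type*} [Fintype κ] (A : Matrix ι κ ℝ) : Matrix ι κ ℝ :=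
  Matrix.of fun i j => Real.exp (A i j) / ∑ j', Real.exp (A i j')

section Eval

variable {V : Type*} [Fintype V] [DecidableEq V] {C : AbstractSimplicialComplex V} {K : ℕ}

/-- One head: `softmax (X Q (X K)ᵀ + φ(ℒ))` applied to the values `X_k V^k`, followed by the
output projection. The matrix `bias` is `φ(ℒ)`. -/
def AttentionHead.eval {d : ℕ} (h : AttentionHead K d)
    (bias : Matrix (FaceUpTo C K) (FaceUpTo C K) ℝ) (X : FaceUpTo C K → Fin d → ℝ) :
    FaceUpTo C K → Fin d → ℝ :=
  let query : FaceUpTo C K → Fin h.dk → ℝ := fun s => Matrix.vecMul (X s) h.WQ + h.bQ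
  let key : FaceUpTo C K → Fin h.dk → ℝ := fun s => Matrix.vecMul (X s) h.WK + h.bK
  let value : FaceUpTo C K → Fin h.dv → ℝ := fun s =>
    Matrix.vecMul (X s) (h.WV s.dim) + h.bV s.dim
  let attention := softmaxRows (Matrix.of (fun s t => dotProduct (query s) (key t)) + bias)
  fun s => Matrix.vecMul (∑ t, attention s t • value t) h.WO

def TransformerLayer.eval {d d' : ℕ} (l : TransformerLayer K d d')
    (bias : Matrix (FaceUpTo C K) (FaceUpTo C K) ℝ) (X : FaceUpTo C K → Fin d → ℝ) :
    FaceUpTo C K → Fin d' → ℝ := fun s =>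
  l.mlp.eval ((if l.residual then X s else 0) + (l.heads.map fun h => h.eval bias X s).sum)

def TransformerLayers.eval (bias : Matrix (FaceUpTo C K) (FaceUpTo C K) ℝ) :
    {d d' : ℕ} → TransformerLayers K d d' → (FaceUpTo C K → Fin d → ℝ) →
      (FaceUpTo C K → Fin d' → ℝ)
  | _, _, .single l, X => l.eval bias X
  | _, _, .cons l rest, X => rest.eval bias (l.eval bias X)

/-- Graph-level pooling over all simplices, or over the `0`-simplices only. -/
def pool {d : ℕ} (scope : PoolingScope) (agg : Aggregation) (X : FaceUpTo C K → Fin d → ℝ) :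
    Fin d → ℝ :=
  match scope with
  | .allSimplices => agg.apply X
  | .vertices => agg.apply fun v : V =>
      X ⟨{v}, C.singleton_mem v, by simp⟩

/-- The output of a simplicial transformer on a graph: it acts on the clique complex, every
simplex of dimension `k` gets the initial feature `x₀ k`, and every attention layer has the bias
`φ(ℒ_{0:K})`, with `φ` applied entrywise. -/
def SimplicialTransformer.eval {d₀ : ℕ} (N : SimplicialTransformer K d₀) (φ : ℝ → ℝ)
    (x₀ : Fin (K + 1) → Fin d₀ → ℝ) (scope : PoolingScope) (agg : Aggregation)
    (G : SimpleGraph V) (o : SimplexOrientation V) : ℝ :=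
  let bias := (interOrderHodgeLaplacian (cliqueComplex G) o K).map φ
  let X := N.layers.eval bias fun s => N.input.eval (x₀ s.dim)
  N.output.eval (pool scope agg X) 0

end Eval

/-- A simplicial transformer distinguishes two graphs if its outputs on them differ, whichever
orientations of the simplices are used to write down the boundary matrices. -/
def SimplicialTransformer.Distinguishes {K d₀ : ℕ} (N : SimplicialTransformer K d₀) (φ : ℝ → ℝ)
    (x₀ : Fin (K + 1) → Fin d₀ → ℝ) (scope : PoolingScope) (agg : Aggregation)
    {V W : Type*} [Fintype V] [DecidableEq V] [Fintype W] [DecidableEq W]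
    (G : SimpleGraph V) (H : SimpleGraph W) : Prop :=
  ∀ (oG : SimplexOrientation V) (oH : SimplexOrientation W),
    N.eval φ x₀ scope agg G oG ≠ N.eval φ x₀ scope agg H oH

end

/-!
The rook's graph and the Shrikhande graph are strongly regular with the same parameters, but the
four squares in a row of the board form a 4-clique, whereas the Shrikhande graph has no 4-clique.
So the clique complex of the first has 3-simplices and that of the second has none.

*The transformer.* One layer with a single head suffices. Its value vector is the constant `1` on
the 3-simplices and `0` on all others; such a choice is possible because every dimension has its
own value matrix and bias. The entries of a softmax are positive whatever the attention bias is, so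
after this layer every simplex of the rook's graph has a positive feature and every simplex of the
Shrikhande graph has the feature `0`. Sum, mean and maximum over a nonempty set preserve this
difference, and neither `φ`, nor the initial features, nor the orientations matter
(`cliqueDetector_eval_pos`, `cliqueDetector_eval_eq_zero`).

*The test 3-WL.* Whether the third vertex of a triple is equal or adjacent to the other two,
counted over all choices of that vertex, is governed by the parameters of a strongly regular graph
and by the isomorphism type of the pair formed by the other two
(`SimpleGraph.IsSRGWith.exists_equiv_pair`). Hence no round refines the initial colouring, and the
colour of a triple is the same function of its isomorphism type in both graphs
(`SameType.wlColor_eq`). Choosing the vertices of a triple one after another gives a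
type-preserving bijection between the triples of the two graphs.
-/

/-! ### 3-WL on strongly regular graphs -/

section SameType

variable {V W : Type*}

/-- Two tuples of vertices, in two graphs, have the same isomorphism type. -/
def SameType (G : SimpleGraph V) (H : SimpleGraph W) {k : ℕ} (v : Fin k → V) (w : Fin k → W) :
    Prop :=
  ∀ i j, (v i = v j ↔ w i = w j) ∧ (G.Adj (v i) (v j) ↔ H.Adj (w i) (w j))

theorem SameType.update {G : SimpleGraph V} {H : SimpleGraph W} {k : ℕ} {v : Fin k → V}
    {w : Fin k → W} (h : SameType G H v w) {i : Fin k} {x : V} {y : W}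
    (hxy : ∀ j ≠ i, (x = v j ↔ y = w j) ∧ (G.Adj (v j) x ↔ H.Adj (w j) y)) :
    SameType G H (Function.update v i x) (Function.update w i y) := by
  intro p q
  by_cases hp : p = i <;> by_cases hq : q = i
  · subst hp; subst hq; simp
  · subst hp
    simpa [Function.update_of_ne hq, G.adj_comm x, H.adj_comm y] using hxy q hq
  · subst hq
    simpa [Function.update_of_ne hp, eq_comm] using hxy p hp
  · simpa [Function.update_of_ne hp, Function.update_of_ne hq] using h p q

end SameType

section WL

variable {V W : Type*} [Fintype V] [DecidableEq V] [Fintype W] [DecidableEq W]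

/-- The number of common neighbours of two vertices of a strongly regular graph, where the two
may coincide. -/
theorem SimpleGraph.IsSRGWith.card_neighborFinset_inter {G : SimpleGraph V} [DecidableRel G.Adj]
    {n k l m : ℕ} (hG : G.IsSRGWith n k l m) (a b : V) :
    (G.neighborFinset a ∩ G.neighborFinset b).card =
      if a = b then k else if G.Adj a b then l else m := by
  have hcard : (G.neighborFinset a ∩ G.neighborFinset b).card =
      Fintype.card (G.commonNeighbors a b) := by
    rw [← Set.toFinset_card]
    congr 1
    ext u
    simp [SimpleGraph.mem_commonNeighbors]
  split_ifs with hab hadj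
  · subst hab
    rw [Finset.inter_self, SimpleGraph.card_neighborFinset_eq_degree, hG.regular a]
  · rw [hcard, hG.of_adj a b hadj]
  · rw [hcard, hG.of_not_adj hab hadj]

/-- How a vertex `u` is related to the pair `a, b`: whether it is equal or adjacent to each. -/
def relationToPair (G : SimpleGraph V) (a b u : V) : Prop × Prop × Prop × Prop :=
  (u = a, u = b, G.Adj a u, G.Adj b u)

open Classical in
/-- In a strongly regular graph, the number of vertices in given relation to a pair `a, b` depends
only on the parameters and on the isomorphism type of the pair. The explicit value matters only in
that it does not mention the graph otherwise; `c` is the number of common neighbours of `a` and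
`b`. -/
theorem SimpleGraph.IsSRGWith.card_relationToPair {G : SimpleGraph V} [DecidableRel G.Adj]
    {n k l m : ℕ} (hG : G.IsSRGWith n k l m) (a b : V) (p q r s : Prop) :
    Fintype.card {u // relationToPair G a b u = (p, q, r, s)} =
      if p then if (q ↔ a = b) ∧ ¬r ∧ (s ↔ G.Adj a b) then 1 else 0
      else if q then if a ≠ b ∧ ¬s ∧ (r ↔ G.Adj a b) then 1 else 0
      else
        let c := if a = b then k else if G.Adj a b then l else m
        if r ∧ s then c
        else if r ∨ s then k - c - if G.Adj a b then 1 else 0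
        else n - (2 * k - c + if G.Adj a b then 0 else if a = b then 1 else 2) := by
  have hI := hG.card_neighborFinset_inter a b
  have hA : (G.neighborFinset a).card = k := hG.regular a
  have hB : (G.neighborFinset b).card = k := hG.regular b
  have hdiff : ∀ {x y : V}, (G.neighborFinset x).card = k →
      ((G.neighborFinset x \ G.neighborFinset y).erase y).card =
        k - (G.neighborFinset x ∩ G.neighborFinset y).card - if G.Adj x y then 1 else 0 := by
    intro x y hx
    have hsub : (G.neighborFinset x \ G.neighborFinset y).card =
        k - (G.neighborFinset x ∩ G.neighborFinset y).card := by
      rw [Finset.card_sdiff, hx, Finset.inter_comm]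
    split_ifs with h
    · rw [Finset.card_erase_of_mem (by simp [h]), hsub]
    · rw [Finset.erase_eq_of_notMem (by simp [h]), hsub, Nat.sub_zero]
  rw [Fintype.card_subtype]
  simp only [relationToPair, Prod.mk.injEq, eq_iff_iff]
  -- If `p` or `q` holds, only `u = a` or only `u = b` can be counted.
  by_cases hp : p
  · simp only [hp, iff_true, if_true]
    rw [← Finset.filter_filter, Finset.filter_eq' Finset.univ a, if_pos (Finset.mem_univ a),
      Finset.filter_singleton]
    simp only [SimpleGraph.irrefl, G.adj_comm b a, false_iff]
    rw [apply_ite Finset.card]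
    simp [iff_comm]
  by_cases hq : q
  · simp only [hp, hq, iff_true, iff_false, if_true, if_false]
    have hrw : (Finset.univ.filter fun u => ¬u = a ∧ u = b ∧ (G.Adj a u ↔ r) ∧ (G.Adj b u ↔ s)) =
        ({b} : Finset V).filter fun u => ¬u = a ∧ (G.Adj a u ↔ r) ∧ (G.Adj b u ↔ s) := by
      ext u
      simp only [Finset.mem_filter, Finset.mem_univ, true_and, Finset.mem_singleton]
      tauto
    rw [hrw, Finset.filter_singleton, apply_ite Finset.card]
    simp only [SimpleGraph.irrefl, false_iff, Finset.card_singleton, Finset.card_empty]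
    refine if_congr ?_ rfl rfl
    rw [eq_comm, ne_eq, iff_comm (a := r)]
    tauto
  simp only [hp, hq, iff_false, if_false]
  -- It remains to count the vertices outside `{a, b}` in the Venn diagram of the neighbourhoods.
  rw [← hI]
  by_cases hr : r <;> by_cases hs : s <;>
    simp only [hr, hs, iff_true, iff_false, and_true, and_false, and_self, or_true, or_false,
      or_self, if_true, if_false]
  · congr 1
    ext u
    have hne : G.Adj a u → u ≠ a := fun h => h.ne'
    have hne' : G.Adj b u → u ≠ b := fun h => h.ne'
    simp
    tauto
  · rw [← hdiff hA]
    congr 1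
    ext u
    have hne : G.Adj a u → u ≠ a := fun h => h.ne'
    simp
    tauto
  · have hcard := hdiff (y := a) hB
    simp only [G.adj_comm b a, Finset.inter_comm (G.neighborFinset b)] at hcard
    rw [← hcard]
    congr 1
    ext u
    have hne : G.Adj b u → u ≠ b := fun h => h.ne'
    simp
    tauto
  · have hU : (G.neighborFinset a ∪ G.neighborFinset b).card =
        2 * k - (G.neighborFinset a ∩ G.neighborFinset b).card := by
      rw [Finset.card_union, hA, hB, two_mul]
    have hcompl : (Finset.univ.filter fun u => ¬u = a ∧ ¬u = b ∧ ¬G.Adj a u ∧ ¬G.Adj b u) =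
        (insert a (insert b (G.neighborFinset a ∪ G.neighborFinset b)))ᶜ := by
      ext u
      simp
    rw [hcompl, Finset.card_compl, hG.card, ← hU]
    congr 1
    -- `a` and `b` lie in the union of the neighbourhoods precisely if they are adjacent.
    split_ifs with hadj hab
    · rw [Finset.insert_eq_of_mem, Finset.insert_eq_of_mem, add_zero] <;> simp [hadj, hadj.symm]
    · subst hab
      rw [Finset.insert_idem, Finset.card_insert_of_notMem (by simp)]
    · rw [Finset.card_insert_of_notMem (by simp [hab, G.adj_comm b a, hadj]),
        Finset.card_insert_of_notMem (by simp [hadj])]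

/-- Between two strongly regular graphs with the same parameters, any two pairs of vertices of the
same isomorphism type are related in the same way to the remaining vertices, up to a bijection. -/
theorem SimpleGraph.IsSRGWith.exists_equiv_pair {G : SimpleGraph V} [DecidableRel G.Adj]
    {H : SimpleGraph W} [DecidableRel H.Adj] {n k l m : ℕ} (hG : G.IsSRGWith n k l m)
    (hH : H.IsSRGWith n k l m) {a b : V} {a' b' : W} (heq : a = b ↔ a' = b')
    (hadj : G.Adj a b ↔ H.Adj a' b') :
    ∃ e : V ≃ W, ∀ u, relationToPair H a' b' (e u) = relationToPair G a b u := by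
  classical
  exact ⟨Equiv.ofFiberEquiv fun c =>
    Fintype.equivOfCardEq (by
      obtain ⟨p, q, r, s⟩ := c
      rw [hG.card_relationToPair, hH.card_relationToPair]
      simp only [ne_eq, heq, hadj]),
    fun u => Equiv.ofFiberEquiv_map _ u⟩

/-- On strongly regular graphs with the same parameters, the 3-WL colour of a triple is determined
by its isomorphism type after any number of rounds. -/
theorem SameType.wlColor_eq {G : SimpleGraph V} [DecidableRel G.Adj]
    {H : SimpleGraph W} [DecidableRel H.Adj] {n k l m : ℕ} (hG : G.IsSRGWith n k l m)
    (hH : H.IsSRGWith n k l m) (t : ℕ) {v : Fin 3 → V} {w : Fin 3 → W} (h : SameType G H v w) :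
    wlColor G 3 t v = wlColor H 3 t w := by
  induction t generalizing v w with
  | zero =>
    refine Prod.ext ?_ ?_ <;> funext i j
    · exact propext (h i j).1
    · exact propext (h i j).2
  | succ t ih =>
    -- The pair at the two positions other than `i` decides how often each type occurs.
    refine Prod.ext (ih h) (funext fun i => ?_)
    obtain ⟨p, q, hpq⟩ : ∃ p q : Fin 3, ∀ j ≠ i, j = p ∨ j = q := by
      revert i; decide
    obtain ⟨e, he⟩ := hG.exists_equiv_pair hH (h p q).1 (h p q).2
    refine Multiset.map_eq_map_of_bij_of_nodup _ _ Finset.univ.nodup Finset.univ.nodup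
      (fun u _ => e u) (fun u _ => Finset.mem_univ _) (fun u _ u' _ hu => e.injective hu)
      (fun y _ => ⟨e.symm y, Finset.mem_univ _, e.apply_symm_apply y⟩) fun u _ => ?_
    refine ih (h.update fun j hj => ?_)
    have := he u
    simp only [relationToPair, Prod.mk.injEq, eq_iff_iff] at this
    rcases hpq j hj with rfl | rfl <;> tauto

/-- 3-WL does not distinguish strongly regular graphs with the same parameters. -/
theorem SimpleGraph.IsSRGWith.not_wlDistinguishes_three {G : SimpleGraph V} [DecidableRel G.Adj]
    {H : SimpleGraph W} [DecidableRel H.Adj] {n k l m : ℕ} (hG : G.IsSRGWith n k l m)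
    (hH : H.IsSRGWith n k l m) : ¬ WLDistinguishes 3 G H := by
  rintro ⟨t, ht⟩
  have hcard : Fintype.card V = Fintype.card W := hG.card.trans hH.card.symm
  let e₀ : V ≃ W := Fintype.equivOfCardEq hcard
  have h₁ : ∀ a, ∃ e : V ≃ W, ∀ u,
      relationToPair H (e₀ a) (e₀ a) (e u) = relationToPair G a a u := fun a =>
    hG.exists_equiv_pair hH (by simp) (by simp)
  choose e₁ he₁ using h₁
  have h₂ : ∀ a b, ∃ e : V ≃ W, ∀ u,
      relationToPair H (e₀ a) (e₁ a b) (e u) = relationToPair G a b u := fun a b => by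
    have := he₁ a b
    simp only [relationToPair, Prod.mk.injEq, eq_iff_iff] at this
    exact hG.exists_equiv_pair hH (by rw [eq_comm, ← this.1, eq_comm]) this.2.2.1.symm
  choose e₂ he₂ using h₂
  -- The vertices are mapped one at a time, each by a bijection that depends on the earlier ones.
  let E : (Fin 3 → V) → (Fin 3 → W) := fun v => ![e₀ (v 0), e₁ (v 0) (v 1), e₂ (v 0) (v 1) (v 2)]
  have hE : Function.Bijective E := by
    rw [Fintype.bijective_iff_injective_and_card]
    refine ⟨fun v v' h => ?_, by simp [hcard]⟩
    have h0 : v 0 = v' 0 := e₀.injective (congrFun h 0)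
    have h1 : v 1 = v' 1 := (e₁ (v 0)).injective (by
      have := congrFun h 1
      simpa [E, ← h0] using this)
    have h2 : v 2 = v' 2 := (e₂ (v 0) (v 1)).injective (by
      have := congrFun h 2
      simpa [E, ← h0, ← h1] using this)
    funext i
    fin_cases i
    exacts [h0, h1, h2]
  have htype : ∀ v, SameType G H v (E v) := by
    intro v
    have r₁ := he₁ (v 0) (v 1)
    have r₂ := he₂ (v 0) (v 1) (v 2)
    simp only [relationToPair, Prod.mk.injEq, eq_iff_iff] at r₁ r₂
    intro i j
    fin_cases i <;> fin_cases j <;>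
      simp [E, G.adj_comm (v 1) (v 0), G.adj_comm (v 2) (v 0), G.adj_comm (v 2) (v 1),
        H.adj_comm (e₁ (v 0) (v 1)) (e₀ (v 0)), H.adj_comm (e₂ (v 0) (v 1) (v 2)), r₁, r₂,
        eq_comm (a := v 0), eq_comm (a := e₀ (v 0)), eq_comm (a := v 1) (b := v 2),
        eq_comm (a := e₁ (v 0) (v 1)) (b := e₂ (v 0) (v 1) (v 2))]
  exact ht (Multiset.map_eq_map_of_bij_of_nodup _ _ Finset.univ.nodup Finset.univ.nodup
    (fun v _ => E v) (fun v _ => Finset.mem_univ _) (fun v _ v' _ h => hE.1 h)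
    (fun y _ => (hE.2 y).imp fun v hv => ⟨Finset.mem_univ _, hv⟩)
    fun v _ => (htype v).wlColor_eq hG hH t)

end WL

/-! ### The two graphs -/

theorem rookGraph_four_isSRGWith : (rookGraph 4).IsSRGWith 16 6 2 2 where
  card := rfl
  regular := by unfold SimpleGraph.IsRegularOfDegree; decide +kernel
  of_adj := by decide +kernel
  of_not_adj := by unfold Pairwise; decide +kernel

theorem shrikhandeGraph_isSRGWith : shrikhandeGraph.IsSRGWith 16 6 2 2 where
  card := rfl
  regular := by unfold SimpleGraph.IsRegularOfDegree; decide +kernel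
  of_adj := by decide +kernel
  of_not_adj := by unfold Pairwise; decide +kernel

/-- The four squares in one row of the board. -/
theorem rookGraph_four_isNClique :
    (rookGraph 4).IsNClique 4 ({(0, 0), (0, 1), (0, 2), (0, 3)} : Finset (Fin 4 × Fin 4)) := by
  rw [SimpleGraph.isNClique_iff, SimpleGraph.isClique_iff, Set.Pairwise]
  simp only [Finset.mem_coe]
  decide

theorem shrikhandeGraph_cliqueFree_four : shrikhandeGraph.CliqueFree 4 := by
  by_contra h
  obtain ⟨f⟩ := (SimpleGraph.not_cliqueFree_iff_top_isContained 4).1 h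
  have hf : ∀ i j : Fin 4, i ≠ j → shrikhandeGraph.Adj (f i) (f j) := fun i j hij =>
    f.toHom.map_adj ((SimpleGraph.top_adj i j).2 hij)
  -- After translating `f 0` to the origin, the other vertices lie in the connection set.
  have key : ∀ x ∈ ({(1, 0), (-1, 0), (0, 1), (0, -1), (1, 1), (-1, -1)} :
      Finset (ZMod 4 × ZMod 4)), ∀ y ∈ ({(1, 0), (-1, 0), (0, 1), (0, -1), (1, 1), (-1, -1)} :
      Finset (ZMod 4 × ZMod 4)), shrikhandeGraph.Adj x y →
      ∀ z ∈ ({(1, 0), (-1, 0), (0, 1), (0, -1), (1, 1), (-1, -1)} :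
      Finset (ZMod 4 × ZMod 4)), ¬ (shrikhandeGraph.Adj x z ∧ shrikhandeGraph.Adj y z) := by
    decide +kernel
  have htrans : ∀ i j : Fin 4, i ≠ j → shrikhandeGraph.Adj (f i - f 0) (f j - f 0) :=
    fun i j hij => by simpa [shrikhandeGraph] using hf i j hij
  exact key _ (hf 0 1 (by decide)) _ (hf 0 2 (by decide)) (htrans 1 2 (by decide)) _
    (hf 0 3 (by decide)) ⟨htrans 1 3 (by decide), htrans 2 3 (by decide)⟩

/-! ### A transformer that detects cliques -/

/-- The simplicial transformer whose only head gives the constant value `1` to the simplices of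
the top dimension `K` and the value `0` to all others, and which passes the result on unchanged. -/
def cliqueDetector (K d₀ : ℕ) : SimplicialTransformer K d₀ where
  d := 1
  d' := 1
  input := .affine 0 0
  layers := .single
    { heads := [
        { dk := 0
          dv := 1
          WQ := 0
          bQ := 0
          WK := 0
          bK := 0
          WV := 0
          bV := fun k _ => if k = Fin.last K then 1 else 0
          WO := 1 }]
      residual := false
      mlp := .affine 1 0 }
  output := .affine 1 0

theorem Aggregation.apply_eq_zero {ι : Type*} [Fintype ι] {d : ℕ} (agg : Aggregation)
    {X : ι → Fin d → ℝ} {c : Fin d} (h : ∀ i, X i c = 0) : agg.apply X c = 0 := by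
  cases agg <;> simp [Aggregation.apply, h]

theorem Aggregation.apply_pos {ι : Type*} [Fintype ι] [Nonempty ι] {d : ℕ} (agg : Aggregation)
    {X : ι → Fin d → ℝ} {c : Fin d} (h : ∀ i, 0 < X i c) : 0 < agg.apply X c := by
  have hsum : 0 < ∑ i, X i c := Finset.sum_pos (fun i _ => h i) Finset.univ_nonempty
  cases agg with
  | sum => exact hsum
  | mean => exact div_pos hsum (Nat.cast_pos.2 Fintype.card_pos)
  | max =>
    obtain ⟨i⟩ := ‹Nonempty ι›
    exact (h i).trans_le (le_ciSup (f := fun i => X i c) (Set.finite_range _).bddAbove i)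

theorem softmaxRows_pos {ι κ : Type*} [Fintype κ] (A : Matrix ι κ ℝ) (i : ι) (j : κ) :
    0 < softmaxRows A i j :=
  div_pos (Real.exp_pos _)
    (Finset.sum_pos (fun _ _ => Real.exp_pos _) ⟨j, Finset.mem_univ j⟩)

section Detector

variable {V : Type*} [Fintype V] [DecidableEq V] {K d₀ : ℕ}

/-- The detector pools the total attention paid to the simplices of the top dimension. -/
theorem cliqueDetector_eval (φ : ℝ → ℝ) (x₀ : Fin (K + 1) → Fin d₀ → ℝ) (scope : PoolingScope)
    (agg : Aggregation) (G : SimpleGraph V) (o : SimplexOrientation V) :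
    (cliqueDetector K d₀).eval φ x₀ scope agg G o =
      pool (d := 1) scope agg (fun (s : FaceUpTo (cliqueComplex G) K) _ =>
        ∑ t, softmaxRows ((interOrderHodgeLaplacian (cliqueComplex G) o K).map φ) s t *
          if t.dim = Fin.last K then 1 else 0) 0 := by
  simp only [SimplicialTransformer.eval, cliqueDetector, MLP.eval, TransformerLayers.eval,
    Matrix.vecMul_one, add_zero]
  congr 1
  funext s c
  have hzero : (Matrix.of fun (_ _ : FaceUpTo (cliqueComplex G) K) => (0 : ℝ)) = 0 := rfl
  simp [TransformerLayer.eval, AttentionHead.eval, MLP.eval, Finset.sum_apply, hzero]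

theorem cliqueDetector_eval_eq_zero {G : SimpleGraph V} (hG : G.CliqueFree (K + 1)) (φ : ℝ → ℝ)
    (x₀ : Fin (K + 1) → Fin d₀ → ℝ) (scope : PoolingScope) (agg : Aggregation)
    (o : SimplexOrientation V) : (cliqueDetector K d₀).eval φ x₀ scope agg G o = 0 := by
  have hdim : ∀ t : FaceUpTo (cliqueComplex G) K, t.dim ≠ Fin.last K := by
    intro t ht
    have hpos : 0 < t.1.card := Finset.card_pos.2 t.2.1.1
    have hcard : t.1.card - 1 = K := congrArg Fin.val ht
    exact hG t.1 ⟨t.2.1.2, by omega⟩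
  rw [cliqueDetector_eval]
  cases scope <;> exact agg.apply_eq_zero fun _ => by simp [hdim]

theorem cliqueDetector_eval_pos {G : SimpleGraph V} {q : Finset V} (hq : G.IsNClique (K + 1) q)
    (φ : ℝ → ℝ) (x₀ : Fin (K + 1) → Fin d₀ → ℝ) (scope : PoolingScope) (agg : Aggregation)
    (o : SimplexOrientation V) : 0 < (cliqueDetector K d₀).eval φ x₀ scope agg G o := by
  have hne : q.Nonempty := Finset.card_pos.1 (by rw [hq.card_eq]; omega)
  let t₀ : FaceUpTo (cliqueComplex G) K := ⟨q, ⟨hne, hq.isClique⟩, hq.card_eq.le⟩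
  have ht₀ : t₀.dim = Fin.last K := Fin.ext (by simp [t₀, FaceUpTo.dim, hq.card_eq])
  have : Nonempty (FaceUpTo (cliqueComplex G) K) := ⟨t₀⟩
  have : Nonempty V := ⟨hne.choose⟩
  have hpos : ∀ s : FaceUpTo (cliqueComplex G) K,
      0 < ∑ t, softmaxRows ((interOrderHodgeLaplacian (cliqueComplex G) o K).map φ) s t *
        if t.dim = Fin.last K then 1 else 0 := fun s =>
    Finset.sum_pos'
      (fun t _ => mul_nonneg (softmaxRows_pos _ s t).le (by split_ifs <;> simp))
      ⟨t₀, Finset.mem_univ _, by simpa [ht₀] using softmaxRows_pos _ s t₀⟩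
  rw [cliqueDetector_eval]
  cases scope <;> exact agg.apply_pos fun _ => hpos _

end Detector

theorem mainTheorem9 :
    (rookGraph 4).IsSRGWith 16 6 2 2 ∧ shrikhandeGraph.IsSRGWith 16 6 2 2 ∧
    IsEmpty (rookGraph 4 ≃g shrikhandeGraph) ∧
    (∀ (φ : ℝ → ℝ) (d₀ : ℕ) (x₀ : Fin (3 + 1) → Fin d₀ → ℝ) (scope : PoolingScope)
      (agg : Aggregation), ∃ N : SimplicialTransformer 3 d₀,
        N.Distinguishes φ x₀ scope agg (rookGraph 4) shrikhandeGraph) ∧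
    ¬ WLDistinguishes 3 (rookGraph 4) shrikhandeGraph := by
  refine ⟨rookGraph_four_isSRGWith, shrikhandeGraph_isSRGWith, ⟨fun f => ?_⟩,
    fun φ d₀ x₀ scope agg => ⟨cliqueDetector 3 d₀, fun oG oH => ?_⟩,
    rookGraph_four_isSRGWith.not_wlDistinguishes_three shrikhandeGraph_isSRGWith⟩
  · exact (shrikhandeGraph_cliqueFree_four.comap ⟨f.toCopy⟩) _ rookGraph_four_isNClique
  · rw [cliqueDetector_eval_eq_zero shrikhandeGraph_cliqueFree_four]
    exact (cliqueDetector_eval_pos rookGraph_four_isNClique φ x₀ scope agg oG).ne'
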